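/- Let $\mathfrak p\ge 2$ and $\nu\ge 1$ be integers, and let $\omega\in\mathbb R^\nu$ be rationally independent, i.e. $n\in\mathbb Z^\nu$ and $n\cdot\omega=0$ imply $n=0$. Write $|n|=\sum_{j=1}^\nu|n_j|$ for $n\in\mathbb Z^\nu$ and $|\omega|=\max_{1\le j\le\nu}|\omega_j|$. Let $\mathcal A>0$ and $0<\kappa\le 1$, let $c:\mathbb Z^\nu\to\mathbb C$ satisfy $$|c(n)|\le \mathcal A^{\frac1{\mathfrak p-1}}e^{-\kappa|n|}\qquad\text{for all } n\in\mathbb Z^\nu,$$ and let $u_0(x)=\sum_{n\in\mathbb Z^\nu}c(n)e^{i(n\cdot\omega)x}$ for $x\in\mathbb R$. Put $\Box=2(6\kappa^{-1})^\nu\mathcal A^{\frac1{\mathfrak p-1}}$ and $$t_0=\min\left\{\frac{\kappa^{(\mathfrak p-1)\nu+1}}{2^{\mathfrak p+1}\,6^{(\mathfrak p-1)\nu+1}\mathcal A|\omega|},\ \frac{\kappa^{(\mathfrak p-1)\nu+1}}{2(\mathfrak p-1)e\,\Box^{\mathfrak p-1}\,12^{(\mathfrak p-1)\nu+1}|\omega|}\right\}.$$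 Then $t_0>0$, and there are a function $u^\dagger:[0,t_0)\times\mathbb R\to\mathbb C$ and coefficients $c^\dagger(t,n)\in\mathbb C$ such that the following hold. (i) $u^\dagger$ is spatially $\omega$-quasi-periodic: $u^\dagger(t,x)=\sum_{n\in\mathbb Z^\nu}c^\dagger(t,n)e^{i(n\cdot\omega)x}$, with absolute convergence, for all $0\le t<t_0$ and $x\in\mathbb R$. (ii) $u^\dagger$ is a classical solution of $\partial_tu+\partial_x^3u+u^{\mathfrak p-1}\partial_xu=0$ on $[0,t_0)\times\mathbb R$: the derivatives $\partial_tu^\dagger$ (one-sided at $t=0$) and $\partial_x^ju^\dagger$, $j\le 3$, exist and are continuous on $[0,t_0)\times\mathbb R$, and the equation holds at every point. (iii) $u^\dagger(0,x)=u_0(x)$ for all $x\in\mathbb R$. (iv) $|c^\dagger(t,n)|\le\Box\, e^{-\frac{\kappa}{2}|n|}$ for all $0\le t<t_0$ and $n\in\mathbb Z^\nu$. -/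

import Mathlib

open Set

noncomputable section

namespace GKdV

/-- The frequency `n · ω = ∑ j, n j * ω j`. -/
def freq {ν : ℕ} (ω : Fin ν → ℝ) (n : Fin ν → ℤ) : ℝ := ∑ j, (n j : ℝ) * ω j

/-- `ω` is rationally independent (non-resonant): `n · ω = 0` with `n ∈ ℤ^ν` implies `n = 0`. -/
def RationallyIndependent {ν : ℕ} (ω : Fin ν → ℝ) : Prop :=
  ∀ n : Fin ν → ℤ, freq ω n = 0 → n = 0

/-- The size `|n| = ∑ j, |n j|` of a lattice point. -/
def latticeSize {ν : ℕ} (n : Fin ν → ℤ) : ℝ := ∑ j, |(n j : ℝ)|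

/-- The size `|ω| = max_j |ω j|` of the wave vector (the norm of `Fin ν → ℝ` is the sup norm).
The times below decrease in `|ω|`, so this smallest choice gives the longest time interval; the
statements with the `ℓ¹` or the Euclidean norm of `ω` follow by restriction in time. -/
def waveSize {ν : ℕ} (ω : Fin ν → ℝ) : ℝ := ‖ω‖

/-- `f(x) = ∑_{n ∈ ℤ^ν} c(n) e^{i (n · ω) x}` for all real `x`. `HasSum` in `ℂ` is absolute
convergence to the given value. -/
def HasFourierExpansion {ν : ℕ} (ω : Fin ν → ℝ) (c : (Fin ν → ℤ) → ℂ) (f : ℝ → ℂ) : Prop :=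
  ∀ x : ℝ, HasSum
    (fun n : Fin ν → ℤ => c n * Complex.exp (Complex.I * ((freq ω n : ℝ) : ℂ) * (x : ℂ))) (f x)

/-- `u` is a classical solution of `∂_t u + ∂_x³ u + u^(p-1) ∂_x u = 0` on `[0, T) × ℝ`: `u(t, ·)` is
three times continuously differentiable, `u(·, x)` is differentiable (from the right at `t = 0`),
`∂_t u` and `∂_x^j u`, `j ≤ 3`, are jointly continuous on `[0, T) × ℝ`, and the equation holds at
every point. -/
structure IsClassicalSolution (p : ℕ) (T : ℝ) (u : ℝ → ℝ → ℂ) : Prop where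
  contDiff_space : ∀ t ∈ Ico 0 T, ContDiff ℝ 3 (u t)
  differentiable_time : ∀ t ∈ Ico 0 T, ∀ x : ℝ,
    DifferentiableWithinAt ℝ (fun s => u s x) (Ico 0 T) t
  continuousOn_space : ∀ j : ℕ, j ≤ 3 →
    ContinuousOn (fun z : ℝ × ℝ => iteratedDeriv j (u z.1) z.2) (Ico 0 T ×ˢ univ)
  continuousOn_time :
    ContinuousOn (fun z : ℝ × ℝ => derivWithin (fun s => u s z.2) (Ico 0 T) z.1)
      (Ico 0 T ×ˢ univ)
  equation : ∀ t ∈ Ico 0 T, ∀ x : ℝ,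
    derivWithin (fun s => u s x) (Ico 0 T) t + iteratedDeriv 3 (u t) x
      + u t x ^ (p - 1) * deriv (u t) x = 0

/-- The constant `□ = 2 (6 κ⁻¹)^ν A^(1/(p-1))`. -/
def box (p ν : ℕ) (A κ : ℝ) : ℝ := 2 * (6 * κ⁻¹) ^ ν * A ^ (1 / ((p : ℝ) - 1))

/-- The existence time, the minimum of
`κ^((p-1)ν+1) / (2^(p+1) 6^((p-1)ν+1) A |ω|)` and
`κ^((p-1)ν+1) / (2 (p-1) e □^(p-1) 12^((p-1)ν+1) |ω|)`. -/
def existenceTime (p : ℕ) {ν : ℕ} (A κ : ℝ) (ω : Fin ν → ℝ) : ℝ :=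
  min
    (κ ^ ((p - 1) * ν + 1) / (2 ^ (p + 1) * 6 ^ ((p - 1) * ν + 1) * A * waveSize ω))
    (κ ^ ((p - 1) * ν + 1) /
      (2 * ((p : ℝ) - 1) * Real.exp 1 * box p ν A κ ^ (p - 1) * 12 ^ ((p - 1) * ν + 1)
        * waveSize ω))

end GKdV

end

namespace GKdV

/-! ### Lattice sums and the frequency map -/

section Lattice

variable {ν : ℕ}

/-! The proof is a Cauchy–Kovalevskaya argument: the width of analyticity is allowed to shrink
linearly in time, and this pays for the derivative in the nonlinearity. With `p = k + 1`, the
nonlinear term is `∂_x (u^(k+1)) / (k+1)`. The coefficient at `n` is multiplied by `exp (α t *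
|n|)`, where `α t = 3κ/5 - b t`. The linear exponent `i (n·ω)³` then acquires the damping `-b|n|`,
and the Duhamel integral gains `1/(b|n|)`, which absorbs the factor `|n·ω| ≤ |ω||n|`
(`mul_norm_exp_mul_integral_le`, `exists_duhamel_operator`).

The weighted coefficients live in `ℓ¹` over the lattice, with values in bounded continuous functions
of time. Because `|m + k| ≤ |m| + |k|` and `α ≥ 0`, the product of series becomes a convolution with
a kernel of norm at most one, so powers obey Banach algebra estimates (`norm_convPow_le`,
`norm_convPow_sub_le`). With `R = □` and `b = 2|ω|R^k`, the Duhamel map is a contraction of the ball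
of radius `R`, the data having norm at most `R/2` (`exists_mild_solution`).

The existence time gives `b t₀ ≤ κ/12`, hence `α ≥ κ/2` throughout. This is the claimed decay, and
it allows the series to be differentiated term by term, which makes the mild solution classical.
Non-resonance serves only to give `ω ≠ 0`. -/

theorem latticeSize_nonneg (n : Fin ν → ℤ) : 0 ≤ latticeSize n :=
  Finset.sum_nonneg fun _ _ => abs_nonneg _

theorem latticeSize_add_le (m n : Fin ν → ℤ) :
    latticeSize (m + n) ≤ latticeSize m + latticeSize n := by
  unfold latticeSize
  rw [← Finset.sum_add_distrib]
  refine Finset.sum_le_sum fun j _ => ?_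
  simpa using abs_add_le (m j : ℝ) (n j : ℝ)

theorem freq_add (ω : Fin ν → ℝ) (m n : Fin ν → ℤ) : freq ω (m + n) = freq ω m + freq ω n := by
  simp [freq, add_mul, Finset.sum_add_distrib]

theorem abs_freq_le (ω : Fin ν → ℝ) (n : Fin ν → ℤ) :
    |freq ω n| ≤ waveSize ω * latticeSize n := by
  unfold freq latticeSize waveSize
  rw [Finset.mul_sum]
  refine (Finset.abs_sum_le_sum_abs _ _).trans (Finset.sum_le_sum fun j _ => ?_)
  rw [abs_mul, mul_comm]
  exact mul_le_mul_of_nonneg_right (norm_le_pi_norm ω j) (abs_nonneg _)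

theorem waveSize_pos (hν : 1 ≤ ν) {ω : Fin ν → ℝ} (hω : RationallyIndependent ω) :
    0 < waveSize ω := by
  refine norm_pos_iff.2 fun h => ?_
  have h1 := hω (fun _ => 1) (by simp [freq, h])
  exact one_ne_zero (congrFun h1 ⟨0, hν⟩)

/-- A two-sided geometric sum, combined with `1 - exp (-x) ≥ x / (1 + x)`, which follows from `exp x
≥ 1 + x`. -/
theorem sum_exp_neg_mul_abs_int_le {x : ℝ} (hx : 0 < x) (N : ℕ) :
    ∑ m ∈ Finset.Icc (-(N : ℤ)) N, Real.exp (-x * |(m : ℝ)|) ≤ (2 + x) / x := by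
  have hq : Real.exp (-x) < 1 := by simpa using hx
  have key : ∀ N : ℕ, ∑ m ∈ Finset.Icc (-(N : ℤ)) N, Real.exp (-x * |(m : ℝ)|)
      = 2 * ∑ k ∈ Finset.range (N + 1), Real.exp (-x) ^ k - 1 := by
    intro N
    induction N with
    | zero => norm_num
    | succ N ih =>
      have h : Finset.Icc (-((N + 1 : ℕ) : ℤ)) ((N + 1 : ℕ) : ℤ)
          = insert (-((N : ℤ) + 1)) (insert ((N : ℤ) + 1) (Finset.Icc (-(N : ℤ)) N)) := by
        ext m
        simp only [Finset.mem_Icc, Finset.mem_insert]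
        push_cast
        omega
      have habs : |(N : ℝ) + 1| = N + 1 := abs_of_nonneg (by positivity)
      rw [h, Finset.sum_insert, Finset.sum_insert, ih, Finset.sum_range_succ _ (N + 1),
        ← Real.exp_nat_mul]
      · push_cast
        rw [abs_neg, habs, mul_comm (-x)]
        ring
      · simp
      · simp only [Finset.mem_insert, Finset.mem_Icc]
        omega
  rw [key]
  have hg : ∑ k ∈ Finset.range (N + 1), Real.exp (-x) ^ k ≤ (1 - Real.exp (-x))⁻¹ := by
    rw [← tsum_geometric_of_lt_one (Real.exp_pos _).le hq]
    exact (summable_geometric_of_lt_one (Real.exp_pos _).le hq).sum_le_tsum _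
      fun _ _ => by positivity
  have he : Real.exp (-x) ≤ (1 + x)⁻¹ := by
    rw [Real.exp_neg]
    exact inv_anti₀ (by linarith) (by linarith [Real.add_one_le_exp x])
  have h1 : x / (1 + x) ≤ 1 - Real.exp (-x) := by
    have : x / (1 + x) = 1 - (1 + x)⁻¹ := by field_simp; ring
    linarith
  have h2 : (1 - Real.exp (-x))⁻¹ ≤ (1 + x) / x := by
    rw [← inv_div]
    exact inv_anti₀ (by positivity) h1
  have h3 : (2 + x) / x = 2 * ((1 + x) / x) - 1 := by field_simp; ring
  linarith

/-- Enlarging `s` to a cube makes the sum factor into `ν` one-dimensional sums. -/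
theorem sum_exp_neg_mul_latticeSize_le {x : ℝ} (hx : 0 < x) (s : Finset (Fin ν → ℤ)) :
    ∑ n ∈ s, Real.exp (-x * latticeSize n) ≤ ((2 + x) / x) ^ ν := by
  set N : ℕ := s.sup fun n => Finset.univ.sup fun j => (n j).natAbs with hN
  have hsub : s ⊆ Fintype.piFinset fun _ : Fin ν => Finset.Icc (-(N : ℤ)) N := by
    intro n hn
    rw [Fintype.mem_piFinset]
    intro j
    have h1 : (n j).natAbs ≤ N :=
      (Finset.le_sup (f := fun j => (n j).natAbs) (Finset.mem_univ j)).trans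
        (Finset.le_sup (f := fun n : Fin ν → ℤ => Finset.univ.sup fun j => (n j).natAbs) hn)
    rw [Finset.mem_Icc]
    omega
  calc ∑ n ∈ s, Real.exp (-x * latticeSize n)
      ≤ ∑ n ∈ Fintype.piFinset fun _ : Fin ν => Finset.Icc (-(N : ℤ)) N,
          Real.exp (-x * latticeSize n) :=
        Finset.sum_le_sum_of_subset_of_nonneg hsub fun _ _ _ => (Real.exp_pos _).le
    _ = ∏ _j : Fin ν, ∑ m ∈ Finset.Icc (-(N : ℤ)) N, Real.exp (-x * |(m : ℝ)|) := by
        rw [Finset.prod_univ_sum]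
        refine Finset.sum_congr rfl fun n _ => ?_
        rw [← Real.exp_sum, latticeSize, Finset.mul_sum]
    _ ≤ ((2 + x) / x) ^ ν := by
        rw [Finset.prod_const, Finset.card_univ, Fintype.card_fin]
        exact pow_le_pow_left₀ (Finset.sum_nonneg fun _ _ => (Real.exp_pos _).le)
          (sum_exp_neg_mul_abs_int_le hx N) _

/-- From `y ^ j / j! ≤ exp y` at `y = r|n|`: any exponential decay pays for any number of space
derivatives. -/
theorem exists_abs_freq_pow_mul_exp_le (ω : Fin ν → ℝ) {r : ℝ} (hr : 0 < r) (j : ℕ) :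
    ∃ C, 0 ≤ C ∧ ∀ n : Fin ν → ℤ, |freq ω n| ^ j * Real.exp (-r * latticeSize n) ≤ C := by
  have hW : 0 ≤ waveSize ω := norm_nonneg _
  refine ⟨(waveSize ω / r) ^ j * j.factorial, by positivity, fun n => ?_⟩
  have hn := latticeSize_nonneg n
  have h1 := Real.pow_div_factorial_le_exp (x := r * latticeSize n) (by positivity) j
  rw [div_le_iff₀ (by positivity)] at h1
  have h2 : |freq ω n| ^ j ≤ (waveSize ω / r) ^ j * (r * latticeSize n) ^ j := by
    rw [← mul_pow]
    refine pow_le_pow_left₀ (abs_nonneg _) ((abs_freq_le ω n).trans (le_of_eq ?_)) _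
    field_simp
  calc |freq ω n| ^ j * Real.exp (-r * latticeSize n)
      ≤ ((waveSize ω / r) ^ j * (Real.exp (r * latticeSize n) * j.factorial))
          * Real.exp (-r * latticeSize n) := by
        gcongr
        exact h2.trans (by gcongr)
    _ = (waveSize ω / r) ^ j * j.factorial
          * (Real.exp (r * latticeSize n) * Real.exp (-r * latticeSize n)) := by ring
    _ = _ := by rw [← Real.exp_add]; simp

end Lattice

/-! ### The `ℓ¹` norm -/

section SummableFamilies

variable {ι E : Type*} [NormedAddCommGroup E]

theorem summable_norm_lp_one (f : lp (fun _ : ι => E) 1) : Summable fun i => ‖f i‖ := by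
  simpa using (lp.memℓp f).summable (by simp)

theorem norm_lp_one_eq_tsum (f : lp (fun _ : ι => E) 1) : ‖f‖ = ∑' i, ‖f i‖ := by
  simpa using lp.norm_eq_tsum_rpow (p := 1) (by simp) f

theorem memℓp_one_of_summable_norm {f : ι → E} (hf : Summable fun i => ‖f i‖) : Memℓp f 1 :=
  memℓp_gen (by simpa using hf)

end SummableFamilies

/-! ### Twisted convolution on `ℓ¹` -/

section TwistedConvolution

variable {Λ E : Type*} [AddCommMonoid Λ] [DecidableEq Λ] [NormedRing E]
  (w : Λ → Λ → E)

/-- The term `w m k * f m * g k`, placed at `m + k`, of the twisted convolution of `f` and `g`. -/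
noncomputable def convTerm (f g : lp (fun _ : Λ => E) 1) (q : Λ × Λ) : lp (fun _ : Λ => E) 1 :=
  lp.single 1 (q.1 + q.2) (w q.1 q.2 * f q.1 * g q.2)

/-- The convolution of summable families, twisted by the kernel `w`. -/
noncomputable def conv (f g : lp (fun _ : Λ => E) 1) : lp (fun _ : Λ => E) 1 :=
  ∑' q, convTerm w f g q

/-- The twisted convolution of `k + 1` copies of `f`. -/
noncomputable def convPow (f : lp (fun _ : Λ => E) 1) : ℕ → lp (fun _ : Λ => E) 1
  | 0 => f
  | k + 1 => conv w (convPow f k) f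

variable {w} (hw : ∀ m k, ‖w m k‖ ≤ 1)
include hw

theorem norm_convTerm_le (f g : lp (fun _ : Λ => E) 1) (q : Λ × Λ) :
    ‖convTerm w f g q‖ ≤ ‖f q.1‖ * ‖g q.2‖ := by
  rw [convTerm, lp.norm_single (by simp)]
  calc ‖w q.1 q.2 * f q.1 * g q.2‖ ≤ ‖w q.1 q.2‖ * ‖f q.1‖ * ‖g q.2‖ :=
        (norm_mul_le _ _).trans (mul_le_mul_of_nonneg_right (norm_mul_le _ _) (norm_nonneg _))
    _ ≤ 1 * ‖f q.1‖ * ‖g q.2‖ := by gcongr; exact hw _ _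
    _ = _ := by rw [one_mul]

omit [AddCommMonoid Λ] [DecidableEq Λ] hw in
theorem summable_norm_mul_norm (f g : lp (fun _ : Λ => E) 1) :
    Summable fun q : Λ × Λ => ‖f q.1‖ * ‖g q.2‖ :=
  (summable_norm_lp_one f).mul_of_nonneg (summable_norm_lp_one g)
    (fun _ => norm_nonneg _) fun _ => norm_nonneg _

theorem norm_conv_le (f g : lp (fun _ : Λ => E) 1) : ‖conv w f g‖ ≤ ‖f‖ * ‖g‖ := by
  have h := (summable_norm_lp_one f).tsum_mul_tsum (summable_norm_lp_one g)
    (summable_norm_mul_norm f g)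
  rw [norm_lp_one_eq_tsum f, norm_lp_one_eq_tsum g, h]
  exact tsum_of_norm_bounded (summable_norm_mul_norm f g).hasSum (norm_convTerm_le hw f g)

theorem norm_convPow_le (f : lp (fun _ : Λ => E) 1) (k : ℕ) :
    ‖convPow w f k‖ ≤ ‖f‖ ^ (k + 1) := by
  induction k with
  | zero => simp [convPow]
  | succ k ih =>
    rw [convPow, pow_succ]
    exact (norm_conv_le hw _ _).trans (mul_le_mul_of_nonneg_right ih (norm_nonneg _))

variable [CompleteSpace E]

theorem summable_convTerm (f g : lp (fun _ : Λ => E) 1) : Summable (convTerm w f g) :=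
  Summable.of_norm_bounded (summable_norm_mul_norm f g) (norm_convTerm_le hw f g)

theorem conv_sub_left (f f' g : lp (fun _ : Λ => E) 1) :
    conv w (f - f') g = conv w f g - conv w f' g := by
  rw [conv, conv, conv, ← (summable_convTerm hw f g).tsum_sub (summable_convTerm hw f' g)]
  refine tsum_congr fun q => ?_
  simp [convTerm, mul_sub, sub_mul, lp.single_sub]

theorem conv_sub_right (f g g' : lp (fun _ : Λ => E) 1) :
    conv w f (g - g') = conv w f g - conv w f g' := by
  rw [conv, conv, conv, ← (summable_convTerm hw f g).tsum_sub (summable_convTerm hw f g')]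
  refine tsum_congr fun q => ?_
  simp [convTerm, mul_sub, lp.single_sub]

/-- Telescoping, one factor at a time. Neither associativity nor commutativity of the twisted
convolution is needed. -/
theorem norm_convPow_sub_le {R : ℝ} {f g : lp (fun _ : Λ => E) 1} (hf : ‖f‖ ≤ R)
    (hg : ‖g‖ ≤ R) (k : ℕ) :
    ‖convPow w f k - convPow w g k‖ ≤ (k + 1) * R ^ k * ‖f - g‖ := by
  have hR : 0 ≤ R := (norm_nonneg f).trans hf
  induction k with
  | zero => simp [convPow]
  | succ k ih =>
    have h : convPow w f (k + 1) - convPow w g (k + 1)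
        = conv w (convPow w f k - convPow w g k) f + conv w (convPow w g k) (f - g) := by
      rw [conv_sub_left hw, conv_sub_right hw, convPow, convPow]
      abel
    rw [h]
    have h1 : ‖conv w (convPow w f k - convPow w g k) f‖ ≤ (k + 1) * R ^ k * ‖f - g‖ * R :=
      (norm_conv_le hw _ _).trans (by gcongr)
    have h2 : ‖conv w (convPow w g k) (f - g)‖ ≤ R ^ (k + 1) * ‖f - g‖ :=
      (norm_conv_le hw _ _).trans (by
        gcongr
        exact (norm_convPow_le hw g k).trans (by gcongr))
    refine (norm_add_le _ _).trans ((add_le_add h1 h2).trans (le_of_eq ?_))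
    push_cast
    ring

/-- A continuous linear functional which turns single terms of the twisted convolution into
products turns the twisted convolution into the product. -/
theorem map_conv {𝕜 : Type*} [RCLike 𝕜] [NormedSpace 𝕜 E]
    (L : lp (fun _ : Λ => E) 1 →L[𝕜] 𝕜)
    (hL : ∀ m k a b, L (lp.single 1 (m + k) (w m k * a * b))
      = L (lp.single 1 m a) * L (lp.single 1 k b))
    (f g : lp (fun _ : Λ => E) 1) : L (conv w f g) = L f * L g := by
  have hsum : ∀ f : lp (fun _ : Λ => E) 1,
      HasSum (fun n => L (lp.single 1 n (f n))) (L f) := fun f =>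
    L.hasSum (lp.hasSum_single (by simp) f)
  have hnorm : ∀ f : lp (fun _ : Λ => E) 1,
      Summable fun n => ‖L (lp.single 1 n (f n))‖ := fun f => by
    refine Summable.of_nonneg_of_le (fun _ => norm_nonneg _) (fun n => ?_)
      ((summable_norm_lp_one f).mul_left ‖L‖)
    refine (L.le_opNorm _).trans (le_of_eq ?_)
    rw [lp.norm_single (by simp)]
  rw [← (hsum f).tsum_eq, ← (hsum g).tsum_eq,
    tsum_mul_tsum_of_summable_norm (hnorm f) (hnorm g), conv,
    L.map_tsum (summable_convTerm hw f g)]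
  exact tsum_congr fun q => hL _ _ _ _

theorem map_convPow {𝕜 : Type*} [RCLike 𝕜] [NormedSpace 𝕜 E]
    (L : lp (fun _ : Λ => E) 1 →L[𝕜] 𝕜)
    (hL : ∀ m k a b, L (lp.single 1 (m + k) (w m k * a * b))
      = L (lp.single 1 m a) * L (lp.single 1 k b))
    (f : lp (fun _ : Λ => E) 1) (k : ℕ) : L (convPow w f k) = L f ^ (k + 1) := by
  induction k with
  | zero => simp [convPow]
  | succ k ih => rw [convPow, map_conv hw L hL, ih, ← pow_succ]

end TwistedConvolution

end GKdV

namespace GKdV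

open scoped BoundedContinuousFunction

/-! ### Exponential weights and evaluation of the series -/

section Weights

variable {ν : ℕ} {α : ℝ → ℝ}

/-- The Fourier coefficient at `n` whose value weighted by `exp (α t * |n|)` is `f n t`. -/
noncomputable def unweight (α : ℝ → ℝ) (f : lp (fun _ : Fin ν → ℤ => ℝ →ᵇ ℂ) 1) (t : ℝ)
    (n : Fin ν → ℤ) : ℂ :=
  f n t * Real.exp (-α t * latticeSize n)

/-- This kernel is what multiplication of series becomes in weighted coefficients; the triangle
inequality for `|n|` and `α ≥ 0` keep it at most one. -/
theorem exists_twist (hα : Continuous α) (h0 : ∀ t, 0 ≤ α t) :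
    ∃ w : (Fin ν → ℤ) → (Fin ν → ℤ) → (ℝ →ᵇ ℂ), (∀ m k, ‖w m k‖ ≤ 1) ∧
      ∀ m k t, w m k t
        = Real.exp (-α t * (latticeSize m + latticeSize k - latticeSize (m + k))) := by
  have hb : ∀ (m k : Fin ν → ℤ) (t : ℝ),
      ‖((Real.exp (-α t * (latticeSize m + latticeSize k - latticeSize (m + k))) : ℝ) : ℂ)‖
        ≤ 1 := by
    intro m k t
    rw [Complex.norm_real, Real.norm_of_nonneg (Real.exp_pos _).le, Real.exp_le_one_iff]
    have := mul_nonneg (h0 t) (sub_nonneg.2 (latticeSize_add_le m k))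
    linarith
  refine ⟨fun m k => BoundedContinuousFunction.ofNormedAddCommGroup
    (fun t => ((Real.exp (-α t * (latticeSize m + latticeSize k - latticeSize (m + k))) : ℝ) : ℂ))
    (by fun_prop) 1 (hb m k), fun m k => ?_, fun m k t => rfl⟩
  exact BoundedContinuousFunction.norm_ofNormedAddCommGroup_le _ zero_le_one (hb m k)

theorem norm_exp_I_mul (y x : ℝ) : ‖Complex.exp (Complex.I * (y : ℂ) * (x : ℂ))‖ = 1 := by
  rw [show Complex.I * (y : ℂ) * (x : ℂ) = ((y * x : ℝ) : ℂ) * Complex.I by push_cast; ring]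
  exact Complex.norm_exp_ofReal_mul_I _

theorem norm_unweight_le {r : ℝ} {t : ℝ} (hr : r ≤ α t)
    (f : lp (fun _ : Fin ν → ℤ => ℝ →ᵇ ℂ) 1) (n : Fin ν → ℤ) :
    ‖unweight α f t n‖ ≤ ‖f n‖ * Real.exp (-r * latticeSize n) := by
  rw [unweight, norm_mul, Complex.norm_real, Real.norm_of_nonneg (Real.exp_pos _).le]
  have := latticeSize_nonneg n
  gcongr
  exact (f n).norm_coe_le_norm t

theorem exists_evaluation (ω : Fin ν → ℝ) {t : ℝ} (h0 : 0 ≤ α t) (x : ℝ) :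
    ∃ L : lp (fun _ : Fin ν → ℤ => ℝ →ᵇ ℂ) 1 →L[ℂ] ℂ, ∀ f,
      HasSum (fun n => unweight α f t n
        * Complex.exp (Complex.I * ((freq ω n : ℝ) : ℂ) * (x : ℂ))) (L f) := by
  have hle : ∀ (f : lp (fun _ : Fin ν → ℤ => ℝ →ᵇ ℂ) 1) n, ‖unweight α f t n
      * Complex.exp (Complex.I * ((freq ω n : ℝ) : ℂ) * (x : ℂ))‖ ≤ ‖f n‖ := by
    intro f n
    rw [norm_mul, norm_exp_I_mul, mul_one]
    simpa using norm_unweight_le (α := α) h0 f n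
  have hs : ∀ f : lp (fun _ : Fin ν → ℤ => ℝ →ᵇ ℂ) 1, Summable fun n => unweight α f t n
      * Complex.exp (Complex.I * ((freq ω n : ℝ) : ℂ) * (x : ℂ)) := fun f =>
    Summable.of_norm_bounded (summable_norm_lp_one f) (hle f)
  let L₀ : lp (fun _ : Fin ν → ℤ => ℝ →ᵇ ℂ) 1 →ₗ[ℂ] ℂ :=
    { toFun := fun f => ∑' n, unweight α f t n
        * Complex.exp (Complex.I * ((freq ω n : ℝ) : ℂ) * (x : ℂ))
      map_add' := fun f g => by
        rw [← (hs f).tsum_add (hs g)]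
        refine tsum_congr fun n => ?_
        simp [unweight, add_mul]
      map_smul' := fun a f => by
        rw [RingHom.id_apply, smul_eq_mul, ← tsum_mul_left]
        refine tsum_congr fun n => ?_
        simp [unweight, mul_assoc] }
  refine ⟨L₀.mkContinuous 1 fun f => ?_, fun f => (hs f).hasSum⟩
  rw [one_mul, norm_lp_one_eq_tsum]
  exact tsum_of_norm_bounded (summable_norm_lp_one f).hasSum (hle f)

/-- Evaluation at `(t, x)` is a bounded functional on `ℓ¹`. The kernel exactly compensates the
mismatch of the weights and `n·ω` is additive, so this functional is multiplicative for the twisted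
convolution. -/
theorem hasSum_unweight_convPow (ω : Fin ν → ℝ) (h0 : ∀ t, 0 ≤ α t)
    {w : (Fin ν → ℤ) → (Fin ν → ℤ) → (ℝ →ᵇ ℂ)} (hw : ∀ m k, ‖w m k‖ ≤ 1)
    (hw' : ∀ m k t, w m k t
        = Real.exp (-α t * (latticeSize m + latticeSize k - latticeSize (m + k))))
    (f : lp (fun _ : Fin ν → ℤ => ℝ →ᵇ ℂ) 1) (k : ℕ) (t x : ℝ) {S : ℂ}
    (hS : HasSum (fun n => unweight α f t n
      * Complex.exp (Complex.I * ((freq ω n : ℝ) : ℂ) * (x : ℂ))) S) :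
    HasSum (fun n => unweight α (convPow w f k) t n
      * Complex.exp (Complex.I * ((freq ω n : ℝ) : ℂ) * (x : ℂ))) (S ^ (k + 1)) := by
  obtain ⟨L, hL⟩ := exists_evaluation (α := α) ω (h0 t) x
  have hsingle : ∀ n a, L (lp.single 1 n a) = a t * Real.exp (-α t * latticeSize n)
      * Complex.exp (Complex.I * ((freq ω n : ℝ) : ℂ) * (x : ℂ)) := by
    intro n a
    refine (hL _).unique ?_
    convert hasSum_single n fun m hm => ?_ using 1
    · rw [unweight, lp.single_apply_self]
    · rw [unweight, lp.single_apply_ne _ _ _ hm]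
      simp
  rw [hS.unique (hL f), ← map_convPow hw L (fun m j a b => ?_)]
  · exact hL _
  · rw [hsingle, hsingle, hsingle, freq_add]
    have h1 : Real.exp (-α t * (latticeSize m + latticeSize j - latticeSize (m + j)))
        * Real.exp (-α t * latticeSize (m + j))
        = Real.exp (-α t * latticeSize m) * Real.exp (-α t * latticeSize j) := by
      rw [← Real.exp_add, ← Real.exp_add]
      ring_nf
    have h2 : Complex.exp (Complex.I * ((freq ω m + freq ω j : ℝ) : ℂ) * (x : ℂ))
        = Complex.exp (Complex.I * ((freq ω m : ℝ) : ℂ) * (x : ℂ))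
          * Complex.exp (Complex.I * ((freq ω j : ℝ) : ℂ) * (x : ℂ)) := by
      rw [← Complex.exp_add]
      push_cast
      ring_nf
    have h1' := congrArg (fun y : ℝ => (y : ℂ)) h1
    simp only [Complex.ofReal_mul] at h1'
    rw [h2, BoundedContinuousFunction.mul_apply, BoundedContinuousFunction.mul_apply, hw']
    linear_combination (a t * b t * Complex.exp (Complex.I * ((freq ω m : ℝ) : ℂ) * (x : ℂ))
          * Complex.exp (Complex.I * ((freq ω j : ℝ) : ℂ) * (x : ℂ))) * h1'

end Weights

/-! ### Duhamel integral and fixed point -/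

section Duhamel

/-- The nearest point to `t` in `[0, T]`. -/
noncomputable def clamp (T t : ℝ) : ℝ := max 0 (min t T)

theorem clamp_nonneg (T t : ℝ) : 0 ≤ clamp T t := le_max_left _ _

theorem clamp_le {T : ℝ} (hT : 0 ≤ T) (t : ℝ) : clamp T t ≤ T := max_le hT (min_le_right _ _)

theorem clamp_of_mem {T t : ℝ} (ht : t ∈ Icc 0 T) : clamp T t = t := by
  rw [clamp, min_eq_left ht.2, max_eq_right ht.1]

theorem continuous_clamp (T : ℝ) : Continuous (clamp T) := by unfold clamp; fun_prop

/-- The smoothing gain: `β ∫₀^τ exp (-β (τ - s)) ds = 1 - exp (-β τ) ≤ 1`. Keeping `β` on the left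
covers `β = 0`, the case of the zero mode. -/
theorem mul_norm_exp_mul_integral_le {μ : ℂ} {β : ℝ} (hμ : μ.re = -β) (hβ : 0 ≤ β) {τ : ℝ}
    (hτ : 0 ≤ τ) (g : ℝ →ᵇ ℂ) :
    β * ‖Complex.exp (μ * τ) * ∫ s in (0 : ℝ)..τ, Complex.exp (-μ * s) * g s‖ ≤ ‖g‖ := by
  have h1 : ‖∫ s in (0 : ℝ)..τ, Complex.exp (-μ * s) * g s‖
      ≤ ∫ s in (0 : ℝ)..τ, Real.exp (β * s) * ‖g‖ := by
    refine intervalIntegral.norm_integral_le_of_norm_le hτ (Filter.Eventually.of_forall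
      fun s _ => ?_) (Continuous.intervalIntegrable (by fun_prop) _ _)
    rw [norm_mul, Complex.norm_exp]
    have : (-μ * (s : ℂ)).re = β * s := by simp [hμ]
    rw [this]
    gcongr
    exact g.norm_coe_le_norm s
  have h2 : β * ∫ s in (0 : ℝ)..τ, Real.exp (β * s) = Real.exp (β * τ) - 1 := by
    rw [← intervalIntegral.integral_const_mul]
    have hd : ∀ s ∈ uIcc 0 τ, HasDerivAt (fun s => Real.exp (β * s)) (β * Real.exp (β * s)) s := by
      intro s _
      have := ((hasDerivAt_id s).const_mul β).exp
      simp only [id, mul_one] at this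
      rwa [mul_comm β]
    rw [intervalIntegral.integral_eq_sub_of_hasDerivAt hd
      (Continuous.intervalIntegrable (by fun_prop) _ _)]
    simp
  have h3 : ‖Complex.exp (μ * τ)‖ = Real.exp (-(β * τ)) := by
    rw [Complex.norm_exp]
    simp [hμ]
  rw [norm_mul, h3]
  rw [intervalIntegral.integral_mul_const] at h1
  calc β * (Real.exp (-(β * τ)) * ‖∫ s in (0 : ℝ)..τ, Complex.exp (-μ * s) * g s‖)
      ≤ β * (Real.exp (-(β * τ)) * ((∫ s in (0 : ℝ)..τ, Real.exp (β * s)) * ‖g‖)) := by gcongr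
    _ = Real.exp (-(β * τ)) * (β * ∫ s in (0 : ℝ)..τ, Real.exp (β * s)) * ‖g‖ := by ring
    _ = (1 - Real.exp (-(β * τ))) * ‖g‖ := by
        rw [h2, mul_sub, ← Real.exp_add]
        simp
    _ ≤ 1 * ‖g‖ := by
        gcongr
        linarith [Real.exp_pos (-(β * τ))]
    _ = ‖g‖ := one_mul _

theorem exists_bounded_duhamel {μ ξ : ℂ} {β K T : ℝ} (hμ : μ.re = -β) (hβ : 0 ≤ β) (hK : 0 ≤ K)
    (hξ : ‖ξ‖ ≤ K * β) (g : ℝ →ᵇ ℂ) :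
    ∃ h : ℝ →ᵇ ℂ, ‖h‖ ≤ K * ‖g‖ ∧ ∀ t, h t = ξ * (Complex.exp (μ * clamp T t)
      * ∫ s in (0 : ℝ)..clamp T t, Complex.exp (-μ * s) * g s) := by
  have hb : ∀ t, ‖ξ * (Complex.exp (μ * clamp T t)
      * ∫ s in (0 : ℝ)..clamp T t, Complex.exp (-μ * s) * g s)‖ ≤ K * ‖g‖ := by
    intro t
    rw [norm_mul]
    refine (mul_le_mul_of_nonneg_right hξ (norm_nonneg _)).trans ?_
    rw [mul_assoc]
    exact mul_le_mul_of_nonneg_left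
      (mul_norm_exp_mul_integral_le hμ hβ (clamp_nonneg T t) g) hK
  have hc : Continuous fun t => ξ * (Complex.exp (μ * clamp T t)
      * ∫ s in (0 : ℝ)..clamp T t, Complex.exp (-μ * s) * g s) := by
    have h1 : Continuous fun τ : ℝ => ∫ s in (0 : ℝ)..τ, Complex.exp (-μ * s) * g s :=
      intervalIntegral.continuous_primitive
        (fun a b => Continuous.intervalIntegrable (by fun_prop) a b) 0
    have h2 := h1.comp (continuous_clamp T)
    have h3 := continuous_clamp T
    simp only [Function.comp_def] at h2
    fun_prop
  exact ⟨BoundedContinuousFunction.ofNormedAddCommGroup _ hc _ hb,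
    BoundedContinuousFunction.norm_ofNormedAddCommGroup_le _ (by positivity) hb, fun t => rfl⟩

theorem exists_fixedPoint_closedBall {X : Type*} [NormedAddCommGroup X] [CompleteSpace X]
    {Φ : X → X} {R : ℝ} (hR : 0 ≤ R) (hΦ : ∀ f, ‖f‖ ≤ R → ‖Φ f‖ ≤ R)
    (hlip : ∀ f g, ‖f‖ ≤ R → ‖g‖ ≤ R → ‖Φ f - Φ g‖ ≤ 1 / 2 * ‖f - g‖) :
    ∃ f, ‖f‖ ≤ R ∧ Φ f = f := by
  have hmaps : MapsTo Φ (Metric.closedBall 0 R) (Metric.closedBall 0 R) := by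
    intro f hf
    rw [mem_closedBall_zero_iff] at hf ⊢
    exact hΦ f hf
  have hcontr : ContractingWith (1 / 2)
      (hmaps.restrict Φ (Metric.closedBall 0 R) (Metric.closedBall 0 R)) := by
    refine ⟨by norm_num, LipschitzWith.of_dist_le_mul fun f g => ?_⟩
    rw [Subtype.dist_eq, Subtype.dist_eq, dist_eq_norm, dist_eq_norm]
    have := hlip f g (mem_closedBall_zero_iff.1 f.2) (mem_closedBall_zero_iff.1 g.2)
    simpa using this
  obtain ⟨f, hf, hfix, -⟩ := hcontr.exists_fixedPoint' Metric.isClosed_closedBall.isComplete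
    hmaps (Metric.mem_closedBall_self hR) (edist_ne_top _ _)
  exact ⟨f, mem_closedBall_zero_iff.1 hf, hfix⟩

end Duhamel

/-! ### Mild solution by contraction -/

section MildSolution

variable {ν : ℕ}

/-- The exponent of the linear flow on the weighted coefficient at `n`, for a weight whose
exponential rate decreases with speed `b`. -/
noncomputable def flowExponent (ω : Fin ν → ℝ) (b : ℝ) (n : Fin ν → ℤ) : ℂ :=
  Complex.I * ((freq ω n : ℝ) : ℂ) ^ 3 - (b : ℂ) * (latticeSize n : ℝ)

theorem flowExponent_re (ω : Fin ν → ℝ) (b : ℝ) (n : Fin ν → ℤ) :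
    (flowExponent ω b n).re = -(b * latticeSize n) := by
  have : flowExponent ω b n
      = ((freq ω n ^ 3 : ℝ) : ℂ) * Complex.I - ((b * latticeSize n : ℝ) : ℂ) := by
    rw [flowExponent]; push_cast; ring
  rw [this, Complex.sub_re, Complex.re_ofReal_mul, Complex.I_re, Complex.ofReal_re]
  simp

/-- The derivative costs `|n·ω| ≤ |ω||n|` and the damping `b|n|` returns `1/(b|n|)`; the quotient is
uniform in `n`. Clamping time to `[0, T]` extends everything to bounded continuous functions on the
line. -/
theorem exists_duhamel_operator (ω : Fin ν → ℝ) {b : ℝ} (hb : 0 < b) (T : ℝ) (k : ℕ) :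
    ∃ J : lp (fun _ : Fin ν → ℤ => ℝ →ᵇ ℂ) 1 → lp (fun _ : Fin ν → ℤ => ℝ →ᵇ ℂ) 1,
      (∀ g, ‖J g‖ ≤ waveSize ω / ((k + 1) * b) * ‖g‖) ∧ (∀ g h, J (g - h) = J g - J h) ∧
      ∀ g n t, J g n t = -(Complex.I * ((freq ω n : ℝ) : ℂ) / (k + 1)) *
        (Complex.exp (flowExponent ω b n * clamp T t) *
          ∫ s in (0 : ℝ)..clamp T t, Complex.exp (-flowExponent ω b n * s) * g n s) := by
  have hW : 0 ≤ waveSize ω := norm_nonneg _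
  have hξ : ∀ n : Fin ν → ℤ, ‖-(Complex.I * ((freq ω n : ℝ) : ℂ) / (k + 1))‖
      ≤ waveSize ω / ((k + 1) * b) * (b * latticeSize n) := by
    intro n
    have hk : ‖(k : ℂ) + 1‖ = k + 1 := by
      rw [show (k : ℂ) + 1 = ((k + 1 : ℕ) : ℂ) by push_cast; ring, Complex.norm_natCast]
      push_cast; ring
    rw [norm_neg, norm_div, norm_mul, Complex.norm_I, one_mul, Complex.norm_real, hk,
      Real.norm_eq_abs]
    have : waveSize ω / ((k + 1) * b) * (b * latticeSize n)
        = waveSize ω * latticeSize n / (k + 1) := by field_simp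
    rw [this]
    gcongr
    exact abs_freq_le ω n
  choose J₀ hJ₀ hJ₀' using fun (n : Fin ν → ℤ) (g : ℝ →ᵇ ℂ) =>
    exists_bounded_duhamel (T := T) (flowExponent_re ω b n)
      (mul_nonneg hb.le (latticeSize_nonneg n)) (by positivity) (hξ n) g
  have hs : ∀ g : lp (fun _ : Fin ν → ℤ => ℝ →ᵇ ℂ) 1, Summable fun n => ‖J₀ n (g n)‖ := fun g =>
    Summable.of_nonneg_of_le (fun _ => norm_nonneg _) (fun n => hJ₀ n (g n))
      ((summable_norm_lp_one g).mul_left _)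
  let J : lp (fun _ : Fin ν → ℤ => ℝ →ᵇ ℂ) 1 → lp (fun _ : Fin ν → ℤ => ℝ →ᵇ ℂ) 1 :=
    fun g => ⟨fun n => J₀ n (g n), memℓp_one_of_summable_norm (hs g)⟩
  have hJ : ∀ g n, J g n = J₀ n (g n) := fun _ _ => rfl
  refine ⟨J, fun g => ?_, fun g h => ?_, fun g n t => by rw [hJ, hJ₀']⟩
  · rw [norm_lp_one_eq_tsum, norm_lp_one_eq_tsum, ← tsum_mul_left]
    exact (hs g).tsum_le_tsum (fun n => hJ₀ n (g n)) ((summable_norm_lp_one g).mul_left _)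
  · ext n t
    rw [lp.coeFn_sub, Pi.sub_apply, BoundedContinuousFunction.sub_apply, hJ, hJ, hJ, hJ₀', hJ₀',
      hJ₀', ← mul_sub, ← mul_sub, ← intervalIntegral.integral_sub]
    · simp [mul_sub]
    · exact Continuous.intervalIntegrable (by fun_prop) _ _
    · exact Continuous.intervalIntegrable (by fun_prop) _ _

theorem exists_mild_solution (ω : Fin ν → ℝ) {a b T R : ℝ} (hb : 0 < b) (hT : 0 ≤ T)
    (k : ℕ) (hbT : b * T ≤ a) (hR : 0 ≤ R) (hbR : 2 * waveSize ω * R ^ k ≤ b)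
    {c : (Fin ν → ℤ) → ℂ} (hc : Summable fun n => ‖c n‖ * Real.exp (a * latticeSize n))
    (hcR : ∑' n, ‖c n‖ * Real.exp (a * latticeSize n) ≤ R / 2) :
    ∃ f g : lp (fun _ : Fin ν → ℤ => ℝ →ᵇ ℂ) 1, ‖f‖ ≤ R ∧
      (∀ (t x : ℝ) (S : ℂ), HasSum (fun n => unweight (fun t => a - b * clamp T t) f t n
          * Complex.exp (Complex.I * ((freq ω n : ℝ) : ℂ) * (x : ℂ))) S →
        HasSum (fun n => unweight (fun t => a - b * clamp T t) g t n
          * Complex.exp (Complex.I * ((freq ω n : ℝ) : ℂ) * (x : ℂ))) (S ^ (k + 1))) ∧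
      ∀ n, ∀ t ∈ Icc 0 T, f n t = Complex.exp (flowExponent ω b n * t) *
        (c n * Real.exp (a * latticeSize n) - Complex.I * ((freq ω n : ℝ) : ℂ) / (k + 1) *
          ∫ s in (0 : ℝ)..t, Complex.exp (-flowExponent ω b n * s) * g n s) := by
  have hα : Continuous fun t => a - b * clamp T t := by
    have := continuous_clamp T
    fun_prop
  have hα0 : ∀ t, 0 ≤ a - b * clamp T t := fun t => by
    have := mul_le_mul_of_nonneg_left (clamp_le hT t) hb.le
    linarith
  obtain ⟨w, hw, hw'⟩ := exists_twist (ν := ν) hα hα0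
  obtain ⟨J, hJ, hJsub, hJ'⟩ := exists_duhamel_operator ω hb T k
  have hb0 : ∀ n t, ‖Complex.exp (flowExponent ω b n * clamp T t)
      * (c n * Real.exp (a * latticeSize n))‖ ≤ ‖c n‖ * Real.exp (a * latticeSize n) := by
    intro n t
    rw [norm_mul, norm_mul, Complex.norm_real, Real.norm_of_nonneg (Real.exp_pos _).le,
      Complex.norm_exp, Complex.re_mul_ofReal, flowExponent_re]
    refine mul_le_of_le_one_left (by positivity) (Real.exp_le_one_iff.2 ?_)
    have := mul_nonneg (mul_nonneg hb.le (latticeSize_nonneg n)) (clamp_nonneg T t)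
    linarith
  have hcont : ∀ n, Continuous fun t => Complex.exp (flowExponent ω b n * clamp T t)
      * (c n * Real.exp (a * latticeSize n)) := fun n => by
    have := continuous_clamp T
    fun_prop
  let F : (Fin ν → ℤ) → (ℝ →ᵇ ℂ) := fun n =>
    BoundedContinuousFunction.ofNormedAddCommGroup _ (hcont n) _ (hb0 n)
  have hF : ∀ n, ‖F n‖ ≤ ‖c n‖ * Real.exp (a * latticeSize n) := fun n =>
    BoundedContinuousFunction.norm_ofNormedAddCommGroup_le _ (by positivity) (hb0 n)
  have hFs : Summable fun n => ‖F n‖ :=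
    Summable.of_nonneg_of_le (fun _ => norm_nonneg _) hF hc
  let f₀ : lp (fun _ : Fin ν → ℤ => ℝ →ᵇ ℂ) 1 := ⟨F, memℓp_one_of_summable_norm hFs⟩
  have hf₀ : ‖f₀‖ ≤ R / 2 := by
    rw [norm_lp_one_eq_tsum]
    exact (hFs.tsum_le_tsum hF hc).trans hcR
  have hW : 0 ≤ waveSize ω := norm_nonneg _
  -- The operator norm of `J` times the Lipschitz constant of the power; this is what dictates
  -- `2|ω|R^k ≤ b`.
  have hK : waveSize ω / ((k + 1) * b) * ((k + 1) * R ^ k) ≤ 1 / 2 := by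
    have : waveSize ω / ((k + 1) * b) * ((k + 1) * R ^ k) = waveSize ω * R ^ k / b := by
      field_simp
    rw [this, div_le_iff₀ hb]
    linarith
  obtain ⟨f, hf, hfix⟩ := exists_fixedPoint_closedBall (Φ := fun f => f₀ + J (convPow w f k)) hR
    (fun f hf => by
      -- A factor `k + 1` is given away so that `hK` also bounds the Duhamel term by `R/2`.
      have h1 : ‖convPow w f k‖ ≤ (k + 1) * R ^ k * R := by
        refine (norm_convPow_le hw f k).trans ?_
        have h2 : ‖f‖ ^ (k + 1) ≤ R ^ k * R := by
          rw [← pow_succ]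
          gcongr
        have h3 : 0 ≤ (k : ℝ) * (R ^ k * R) := by positivity
        linarith
      have h4 : ‖J (convPow w f k)‖ ≤ 1 / 2 * R :=
        (hJ _).trans ((mul_le_mul_of_nonneg_left h1 (by positivity)).trans (by
          rw [← mul_assoc]
          exact mul_le_mul_of_nonneg_right hK hR))
      refine (norm_add_le _ _).trans ?_
      linarith)
    (fun f g hf hg => by
      rw [add_sub_add_left_eq_sub, ← hJsub]
      refine (hJ _).trans ((mul_le_mul_of_nonneg_left (norm_convPow_sub_le hw hf hg k)
        (by positivity)).trans ?_)
      rw [← mul_assoc]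
      exact mul_le_mul_of_nonneg_right hK (norm_nonneg _))
  refine ⟨f, convPow w f k, hf, fun t x S hS =>
    hasSum_unweight_convPow ω hα0 hw hw' f k t x hS, fun n t ht => ?_⟩
  have h1 : f n t = F n t + J (convPow w f k) n t := by
    conv_lhs => rw [← hfix]
    rfl
  have h2 : F n t = Complex.exp (flowExponent ω b n * clamp T t)
      * (c n * Real.exp (a * latticeSize n)) := rfl
  rw [h1, h2, hJ', clamp_of_mem ht]
  ring

end MildSolution

end GKdV

namespace GKdV

open scoped BoundedContinuousFunction

/-! ### Space derivatives of the series -/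

section SpaceDerivatives

variable {ν : ℕ} {α : ℝ → ℝ}

/-- The `j`-th space derivative of the Fourier series with weighted coefficients `f`. -/
noncomputable def fourierSum (ω : Fin ν → ℝ) (α : ℝ → ℝ)
    (f : lp (fun _ : Fin ν → ℤ => ℝ →ᵇ ℂ) 1) (j : ℕ) (t x : ℝ) : ℂ :=
  ∑' n, unweight α f t n * (Complex.I * ((freq ω n : ℝ) : ℂ)) ^ j
    * Complex.exp (Complex.I * ((freq ω n : ℝ) : ℂ) * (x : ℂ))

theorem continuous_unweight (hα : Continuous α) (f : lp (fun _ : Fin ν → ℤ => ℝ →ᵇ ℂ) 1)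
    (n : Fin ν → ℤ) : Continuous fun t => unweight α f t n := by
  unfold unweight
  fun_prop

theorem exists_norm_unweight_mul_le (ω : Fin ν → ℝ) {r : ℝ} (hr : 0 < r) (hα : ∀ t, r ≤ α t)
    (f : lp (fun _ : Fin ν → ℤ => ℝ →ᵇ ℂ) 1) (j : ℕ) :
    ∃ B : (Fin ν → ℤ) → ℝ, Summable B ∧ ∀ n t,
      ‖unweight α f t n * (Complex.I * ((freq ω n : ℝ) : ℂ)) ^ j‖ ≤ B n := by
  obtain ⟨C, hC, hle⟩ := exists_abs_freq_pow_mul_exp_le ω hr j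
  refine ⟨fun n => ‖f n‖ * C, (summable_norm_lp_one f).mul_right C, fun n t => ?_⟩
  rw [norm_mul, norm_pow, norm_mul, Complex.norm_I, one_mul, Complex.norm_real, Real.norm_eq_abs]
  calc ‖unweight α f t n‖ * |freq ω n| ^ j
      ≤ ‖f n‖ * Real.exp (-r * latticeSize n) * |freq ω n| ^ j := by
        gcongr
        exact norm_unweight_le (hα t) f n
    _ = ‖f n‖ * (|freq ω n| ^ j * Real.exp (-r * latticeSize n)) := by ring
    _ ≤ ‖f n‖ * C := by gcongr; exact hle n

theorem hasSum_fourierSum (ω : Fin ν → ℝ) {r : ℝ} (hr : 0 < r) (hα : ∀ t, r ≤ α t)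
    (f : lp (fun _ : Fin ν → ℤ => ℝ →ᵇ ℂ) 1) (j : ℕ) (t x : ℝ) :
    HasSum (fun n => unweight α f t n * (Complex.I * ((freq ω n : ℝ) : ℂ)) ^ j
      * Complex.exp (Complex.I * ((freq ω n : ℝ) : ℂ) * (x : ℂ))) (fourierSum ω α f j t x) := by
  obtain ⟨B, hB, hle⟩ := exists_norm_unweight_mul_le ω hr hα f j
  refine (Summable.of_norm_bounded hB fun n => ?_).hasSum
  rw [norm_mul, norm_exp_I_mul, mul_one]
  exact hle n t

theorem hasDerivAt_exp_mul_ofReal (z : ℂ) (x : ℝ) :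
    HasDerivAt (fun y : ℝ => Complex.exp (z * (y : ℂ))) (z * Complex.exp (z * (x : ℂ))) x := by
  have h := (((hasDerivAt_id (x : ℂ)).const_mul z).cexp).comp_ofReal
  simp only [id, mul_one] at h
  rwa [mul_comm z]

theorem hasDerivAt_fourierSum (ω : Fin ν → ℝ) {r : ℝ} (hr : 0 < r) (hα : ∀ t, r ≤ α t)
    (f : lp (fun _ : Fin ν → ℤ => ℝ →ᵇ ℂ) 1) (j : ℕ) (t x : ℝ) :
    HasDerivAt (fourierSum ω α f j t) (fourierSum ω α f (j + 1) t x) x := by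
  obtain ⟨B, hB, hle⟩ := exists_norm_unweight_mul_le ω hr hα f (j + 1)
  unfold fourierSum
  refine hasDerivAt_tsum (𝕜 := ℝ) (y₀ := 0)
    (g := fun n y => unweight α f t n * (Complex.I * ((freq ω n : ℝ) : ℂ)) ^ j
      * Complex.exp (Complex.I * ((freq ω n : ℝ) : ℂ) * (y : ℂ)))
    (g' := fun n y => unweight α f t n * (Complex.I * ((freq ω n : ℝ) : ℂ)) ^ (j + 1)
      * Complex.exp (Complex.I * ((freq ω n : ℝ) : ℂ) * (y : ℂ)))
    hB (fun n y => ?_) (fun n y => ?_) (hasSum_fourierSum ω hr hα f j t 0).summable x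
  · refine ((hasDerivAt_exp_mul_ofReal (Complex.I * ((freq ω n : ℝ) : ℂ)) y).const_mul
      (unweight α f t n * (Complex.I * ((freq ω n : ℝ) : ℂ)) ^ j)).congr_deriv ?_
    ring
  · rw [norm_mul, norm_exp_I_mul, mul_one]
    exact hle n t

theorem iteratedDeriv_fourierSum (ω : Fin ν → ℝ) {r : ℝ} (hr : 0 < r) (hα : ∀ t, r ≤ α t)
    (f : lp (fun _ : Fin ν → ℤ => ℝ →ᵇ ℂ) 1) (j : ℕ) (t : ℝ) :
    iteratedDeriv j (fourierSum ω α f 0 t) = fourierSum ω α f j t := by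
  induction j with
  | zero => exact iteratedDeriv_zero
  | succ j ih =>
    rw [iteratedDeriv_succ, ih]
    exact funext fun x => (hasDerivAt_fourierSum ω hr hα f j t x).deriv

theorem contDiff_fourierSum (ω : Fin ν → ℝ) {r : ℝ} (hr : 0 < r) (hα : ∀ t, r ≤ α t)
    (f : lp (fun _ : Fin ν → ℤ => ℝ →ᵇ ℂ) 1) (N : ℕ) (t : ℝ) :
    ContDiff ℝ N (fourierSum ω α f 0 t) := by
  refine contDiff_of_differentiable_iteratedDeriv (n := (N : ℕ∞)) fun m _ => ?_
  rw [iteratedDeriv_fourierSum ω hr hα]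
  exact fun x => (hasDerivAt_fourierSum ω hr hα f m t x).differentiableAt

theorem continuous_fourierSum (ω : Fin ν → ℝ) {r : ℝ} (hr : 0 < r) (hαc : Continuous α)
    (hα : ∀ t, r ≤ α t) (f : lp (fun _ : Fin ν → ℤ => ℝ →ᵇ ℂ) 1) (j : ℕ) :
    Continuous fun z : ℝ × ℝ => fourierSum ω α f j z.1 z.2 := by
  obtain ⟨B, hB, hle⟩ := exists_norm_unweight_mul_le ω hr hα f j
  refine continuous_tsum (fun n => ?_) hB fun n z => ?_
  · have : Continuous fun z : ℝ × ℝ => unweight α f z.1 n :=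
      (continuous_unweight hαc f n).comp continuous_fst
    fun_prop
  · rw [norm_mul, norm_exp_I_mul, mul_one]
    exact hle n z.1

end SpaceDerivatives

/-! ### Time derivative of the series -/

section TimeDerivative

variable {ν : ℕ}

/-- Removing the weight cancels the damping: `exp (-(a - b t)|n|) * exp (-b t|n|) = exp (-a|n|)`.
What remains is the Duhamel formula of the original equation. -/
theorem unweight_eq_duhamel (ω : Fin ν → ℝ) {a b T : ℝ} (k : ℕ) {c : (Fin ν → ℤ) → ℂ}
    {f g : lp (fun _ : Fin ν → ℤ => ℝ →ᵇ ℂ) 1} {n : Fin ν → ℤ} {t : ℝ} (ht : t ∈ Icc 0 T)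
    (hfg : f n t = Complex.exp (flowExponent ω b n * t) *
        (c n * Real.exp (a * latticeSize n) - Complex.I * ((freq ω n : ℝ) : ℂ) / (k + 1) *
          ∫ s in (0 : ℝ)..t, Complex.exp (-flowExponent ω b n * s) * g n s)) :
    unweight (fun t => a - b * clamp T t) f t n
      = Complex.exp (Complex.I * ((freq ω n : ℝ) : ℂ) ^ 3 * t) *
        (c n - Complex.I * ((freq ω n : ℝ) : ℂ) / (k + 1) *
          ∫ s in (0 : ℝ)..t, Complex.exp (-(Complex.I * ((freq ω n : ℝ) : ℂ) ^ 3) * s)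
            * unweight (fun t => a - b * clamp T t) g s n) := by
  have hint : ∫ s in (0 : ℝ)..t, Complex.exp (-(Complex.I * ((freq ω n : ℝ) : ℂ) ^ 3) * s)
        * unweight (fun t => a - b * clamp T t) g s n
      = Complex.exp (-(a * latticeSize n))
        * ∫ s in (0 : ℝ)..t, Complex.exp (-flowExponent ω b n * s) * g n s := by
    rw [← intervalIntegral.integral_const_mul]
    refine intervalIntegral.integral_congr fun s hs => ?_
    rw [uIcc_of_le ht.1] at hs
    have h1 : Complex.exp (-(a * latticeSize n)) * Complex.exp (-flowExponent ω b n * s)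
        = Complex.exp (-(Complex.I * ((freq ω n : ℝ) : ℂ) ^ 3) * s)
          * Complex.exp (-(a - b * s) * latticeSize n) := by
      rw [← Complex.exp_add, ← Complex.exp_add, flowExponent]
      ring_nf
    simp only [unweight]
    rw [clamp_of_mem ⟨hs.1, hs.2.trans ht.2⟩]
    push_cast
    linear_combination (-(g n s)) * h1
  have h2 : Complex.exp (flowExponent ω b n * t) * Complex.exp (-(a - b * t) * latticeSize n)
      = Complex.exp (Complex.I * ((freq ω n : ℝ) : ℂ) ^ 3 * t)
        * Complex.exp (-(a * latticeSize n)) := by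
    rw [← Complex.exp_add, ← Complex.exp_add, flowExponent]
    ring_nf
  have h3 : Complex.exp (-((a : ℂ) * latticeSize n)) * Complex.exp (a * latticeSize n) = 1 := by
    rw [← Complex.exp_add]
    simp
  rw [hint, unweight, hfg, clamp_of_mem ht]
  push_cast
  linear_combination (c n * Complex.exp (a * latticeSize n)
    - Complex.I * ((freq ω n : ℝ) : ℂ) / (k + 1) *
      ∫ s in (0 : ℝ)..t, Complex.exp (-flowExponent ω b n * s) * g n s) * h2
    + Complex.exp (Complex.I * ((freq ω n : ℝ) : ℂ) ^ 3 * t) * c n * h3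

/-- Variation of constants in integrated form: if `v` agrees on `[0, T]` with the Duhamel formula
for `v' = μ v - ξ g`, then `v` is `v 0` plus the integral of `μ v - ξ g`. -/
theorem eq_add_integral_of_duhamel {μ ξ v₀ : ℂ} {v g : ℝ → ℂ}
    (hg : Continuous g) {T : ℝ}
    (h : ∀ t ∈ Icc 0 T, v t = Complex.exp (μ * t)
      * (v₀ - ξ * ∫ s in (0 : ℝ)..t, Complex.exp (-μ * s) * g s))
    {t : ℝ} (ht : t ∈ Icc 0 T) : v t = v₀ + ∫ s in (0 : ℝ)..t, (μ * v s - ξ * g s) := by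
  -- The formula makes sense for every real `t` and can be differentiated there, whereas `v` is
  -- known only on `[0, T]`.
  set V : ℝ → ℂ := fun t => Complex.exp (μ * t)
      * (v₀ - ξ * ∫ s in (0 : ℝ)..t, Complex.exp (-μ * s) * g s) with hV
  have hVd : ∀ t, HasDerivAt V (μ * V t - ξ * g t) t := by
    intro t
    have h1 : HasDerivAt (fun t : ℝ => ∫ s in (0 : ℝ)..t, Complex.exp (-μ * s) * g s)
        (Complex.exp (-μ * t) * g t) t :=
      intervalIntegral.integral_hasDerivAt_right
        (Continuous.intervalIntegrable (by fun_prop) _ _)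
        (Continuous.stronglyMeasurableAtFilter (by fun_prop) _ _)
        (Continuous.continuousAt (by fun_prop))
    refine ((hasDerivAt_exp_mul_ofReal μ t).mul ((h1.const_mul ξ).const_sub v₀)).congr_deriv ?_
    have h2 : Complex.exp (μ * t) * Complex.exp (-μ * t) = 1 := by
      rw [← Complex.exp_add]
      simp
    simp only [hV]
    linear_combination (-ξ * g t) * h2
  have hVc : Continuous V := continuous_iff_continuousAt.2 fun t => (hVd t).continuousAt
  have hftc := intervalIntegral.integral_eq_sub_of_hasDerivAt (a := 0) (b := t)
    (fun s _ => hVd s) (Continuous.intervalIntegrable (by fun_prop) _ _)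
  have hcongr : ∫ s in (0 : ℝ)..t, (μ * v s - ξ * g s)
      = ∫ s in (0 : ℝ)..t, (μ * V s - ξ * g s) := by
    refine intervalIntegral.integral_congr fun s hs => ?_
    rw [uIcc_of_le ht.1] at hs
    rw [h s ⟨hs.1, hs.2.trans ht.2⟩]
  have hV0 : V 0 = v₀ := by simp [hV]
  rw [hcongr, hftc, hV0, h t ht]
  simp [hV]

theorem hasDerivWithinAt_fourierSum (ω : Fin ν → ℝ) {α : ℝ → ℝ} (hαc : Continuous α) {r T : ℝ}
    (hr : 0 < r) (hα : ∀ t, r ≤ α t) (k : ℕ) {c : (Fin ν → ℤ) → ℂ}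
    {f g : lp (fun _ : Fin ν → ℤ => ℝ →ᵇ ℂ) 1}
    (hfg : ∀ n, ∀ t ∈ Icc 0 T, unweight α f t n
      = Complex.exp (Complex.I * ((freq ω n : ℝ) : ℂ) ^ 3 * t) *
        (c n - Complex.I * ((freq ω n : ℝ) : ℂ) / (k + 1) *
          ∫ s in (0 : ℝ)..t, Complex.exp (-(Complex.I * ((freq ω n : ℝ) : ℂ) ^ 3) * s)
            * unweight α g s n))
    {t : ℝ} (ht : t ∈ Ico 0 T) (x : ℝ) :
    HasDerivWithinAt (fun s => fourierSum ω α f 0 s x)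
      (-fourierSum ω α f 3 t x - fourierSum ω α g 1 t x / (k + 1)) (Ico 0 T) t := by
  set e : (Fin ν → ℤ) → ℂ := fun n =>
    Complex.exp (Complex.I * ((freq ω n : ℝ) : ℂ) * (x : ℂ)) with he
  set h : (Fin ν → ℤ) → ℝ → ℂ := fun n s =>
    Complex.I * ((freq ω n : ℝ) : ℂ) ^ 3 * unweight α f s n
      - Complex.I * ((freq ω n : ℝ) : ℂ) / (k + 1) * unweight α g s n with hh
  have hfc := fun n => continuous_unweight hαc f n
  have hgc := fun n => continuous_unweight hαc g n
  have hhc : ∀ n, Continuous (h n) := fun n => by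
    have := hfc n
    have := hgc n
    fun_prop
  have hcoef : ∀ n, ∀ s ∈ Icc 0 T, unweight α f s n = c n + ∫ y in (0 : ℝ)..s, h n y :=
    fun n s hs => eq_add_integral_of_duhamel (hgc n) (hfg n) hs
  have h0 : (0 : ℝ) ∈ Icc 0 T := ⟨le_rfl, ht.1.trans ht.2.le⟩
  have hterm : ∀ n s, h n s * e n
      = -(unweight α f s n * (Complex.I * ((freq ω n : ℝ) : ℂ)) ^ 3 * e n)
        - unweight α g s n * (Complex.I * ((freq ω n : ℝ) : ℂ)) ^ 1 * e n / (k + 1) := by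
    intro n s
    have : (Complex.I * ((freq ω n : ℝ) : ℂ)) ^ 3 = -(Complex.I * ((freq ω n : ℝ) : ℂ) ^ 3) := by
      rw [mul_pow, Complex.I_pow_three]
      ring
    rw [this]
    simp only [hh]
    ring
  have hk : ‖(k : ℂ) + 1‖ = k + 1 := by
    rw [show (k : ℂ) + 1 = ((k + 1 : ℕ) : ℂ) by push_cast; ring, Complex.norm_natCast]
    push_cast; ring
  obtain ⟨B, hB, hBle⟩ := exists_norm_unweight_mul_le ω hr hα f 3
  obtain ⟨D, hD, hDle⟩ := exists_norm_unweight_mul_le ω hr hα g 1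
  have hbound : ∀ n s, ‖h n s * e n‖ ≤ B n + D n / (k + 1) := by
    intro n s
    rw [hterm]
    refine (norm_sub_le _ _).trans (add_le_add ?_ ?_)
    · rw [norm_neg, norm_mul, he, norm_exp_I_mul, mul_one]
      exact hBle n s
    · rw [norm_div, norm_mul, he, norm_exp_I_mul, mul_one, hk]
      gcongr
      exact hDle n s
  have hsum : HasSum (fun n => h n t * e n)
      (-fourierSum ω α f 3 t x - fourierSum ω α g 1 t x / (k + 1)) := by
    simp only [hterm]
    exact (hasSum_fourierSum ω hr hα f 3 t x).neg.sub
      ((hasSum_fourierSum ω hr hα g 1 t x).div_const _)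
  -- The integrated coefficients are differentiable on the whole line with summable bounds, so the
  -- series has a two-sided derivative; it agrees with the solution on `[0, T)`, which yields the
  -- one-sided derivative at `0`.
  have hderiv : HasDerivAt (fun s => ∑' n, (c n + ∫ y in (0 : ℝ)..s, h n y) * e n)
      (∑' n, h n t * e n) t := by
    refine hasDerivAt_tsum (y₀ := 0) (hB.add (hD.div_const _)) (fun n s => ?_) hbound ?_ t
    · refine HasDerivAt.mul_const (HasDerivAt.const_add _ ?_) _
      exact intervalIntegral.integral_hasDerivAt_right ((hhc n).intervalIntegrable _ _)
        ((hhc n).stronglyMeasurableAtFilter _ _) (hhc n).continuousAt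
    · refine (hasSum_fourierSum ω hr hα f 0 0 x).summable.congr fun n => ?_
      rw [pow_zero, mul_one, hcoef n 0 h0]
  rw [hsum.tsum_eq] at hderiv
  have hcongr : ∀ s ∈ Ico 0 T, fourierSum ω α f 0 s x
      = ∑' n, (c n + ∫ y in (0 : ℝ)..s, h n y) * e n := fun s hs =>
    tsum_congr fun n => by rw [pow_zero, mul_one, hcoef n s ⟨hs.1, hs.2.le⟩]
  exact hderiv.hasDerivWithinAt.congr hcongr (hcongr t ht)

end TimeDerivative

/-! ### The equation -/

section ClassicalSolution

variable {ν : ℕ}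

theorem isClassicalSolution_fourierSum (ω : Fin ν → ℝ) {α : ℝ → ℝ} (hαc : Continuous α)
    {r T : ℝ} (hr : 0 < r) (hα : ∀ t, r ≤ α t) (k : ℕ) {c : (Fin ν → ℤ) → ℂ}
    {f g : lp (fun _ : Fin ν → ℤ => ℝ →ᵇ ℂ) 1}
    (hpow : ∀ t x, fourierSum ω α g 0 t x = fourierSum ω α f 0 t x ^ (k + 1))
    (hfg : ∀ n, ∀ t ∈ Icc 0 T, unweight α f t n
      = Complex.exp (Complex.I * ((freq ω n : ℝ) : ℂ) ^ 3 * t) *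
        (c n - Complex.I * ((freq ω n : ℝ) : ℂ) / (k + 1) *
          ∫ s in (0 : ℝ)..t, Complex.exp (-(Complex.I * ((freq ω n : ℝ) : ℂ) ^ 3) * s)
            * unweight α g s n)) :
    IsClassicalSolution (k + 1) T (fourierSum ω α f 0) := by
  -- The series of `g` sums to `u^(k+1)`, so uniqueness of the derivative gives the chain rule
  -- without manipulating convolutions.
  have hg1 : ∀ t x, fourierSum ω α g 1 t x
      = (k + 1) * fourierSum ω α f 0 t x ^ k * fourierSum ω α f 1 t x := by
    intro t x
    have h1 := (hasDerivAt_fourierSum ω hr hα f 0 t x).pow (k + 1)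
    have h2 := hasDerivAt_fourierSum ω hr hα g 0 t x
    rw [show fourierSum ω α g 0 t = fourierSum ω α f 0 t ^ (k + 1) from funext (hpow t)] at h2
    simpa using h2.unique h1
  have hk : (k : ℂ) + 1 ≠ 0 := by exact_mod_cast Nat.succ_ne_zero k
  have htime : ∀ t ∈ Ico 0 T, ∀ x, HasDerivWithinAt (fun s => fourierSum ω α f 0 s x)
      (-fourierSum ω α f 3 t x - fourierSum ω α f 0 t x ^ k * fourierSum ω α f 1 t x)
      (Ico 0 T) t := by
    intro t ht x
    convert hasDerivWithinAt_fourierSum ω hαc hr hα k hfg ht x using 1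
    rw [hg1]
    field_simp
  have hderiv : ∀ t ∈ Ico 0 T, ∀ x, derivWithin (fun s => fourierSum ω α f 0 s x) (Ico 0 T) t
      = -fourierSum ω α f 3 t x - fourierSum ω α f 0 t x ^ k * fourierSum ω α f 1 t x :=
    fun t ht x => (htime t ht x).derivWithin (uniqueDiffOn_Ico 0 T t ht)
  refine ⟨fun t _ => contDiff_fourierSum ω hr hα f 3 t,
    fun t ht x => (htime t ht x).differentiableWithinAt, fun j _ => ?_, ?_, fun t ht x => ?_⟩
  · simp only [iteratedDeriv_fourierSum ω hr hα]
    exact (continuous_fourierSum ω hr hαc hα f j).continuousOn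
  · have h0 := continuous_fourierSum ω hr hαc hα f 0
    have h1 := continuous_fourierSum ω hr hαc hα f 1
    have h3 := continuous_fourierSum ω hr hαc hα f 3
    have hcont : Continuous fun z : ℝ × ℝ => -fourierSum ω α f 3 z.1 z.2
        - fourierSum ω α f 0 z.1 z.2 ^ k * fourierSum ω α f 1 z.1 z.2 := by fun_prop
    exact hcont.continuousOn.congr fun z hz => hderiv z.1 hz.1 z.2
  · rw [hderiv t ht, iteratedDeriv_fourierSum ω hr hα,
      (hasDerivAt_fourierSum ω hr hα f 0 t x).deriv, Nat.add_sub_cancel]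
    ring

end ClassicalSolution

/-! ### The constants `□` and `t₀` -/

section Constants

variable {ν : ℕ}

theorem box_pos (p ν : ℕ) {A κ : ℝ} (hA : 0 < A) (hκ : 0 < κ) : 0 < box p ν A κ := by
  unfold box
  positivity

theorem existenceTime_pos {p : ℕ} (hp : 2 ≤ p) {A κ : ℝ} (hA : 0 < A) (hκ : 0 < κ)
    {ω : Fin ν → ℝ} (hω : 0 < waveSize ω) : 0 < existenceTime p A κ ω := by
  have hbox := box_pos p ν hA hκ
  have hp' : (0 : ℝ) < (p : ℝ) - 1 := by
    have : (2 : ℝ) ≤ p := by exact_mod_cast hp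
    linarith
  unfold existenceTime
  exact lt_min (by positivity) (by positivity)

/-- Bounds the total loss of analyticity width. The second entry of the minimum suffices, after
discarding `k`, `e`, and all but one power of `κ` and of `12`. -/
theorem mul_existenceTime_le {k : ℕ} (hk : 1 ≤ k) {A κ : ℝ} (hA : 0 < A) (hκ : 0 < κ)
    (hκ1 : κ ≤ 1) {ω : Fin ν → ℝ} (hω : 0 < waveSize ω) :
    2 * waveSize ω * box (k + 1) ν A κ ^ k * existenceTime (k + 1) A κ ω ≤ κ / 12 := by
  have hbox := box_pos (k + 1) ν hA hκ
  have hk' : (1 : ℝ) ≤ k := by exact_mod_cast hk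
  have he : 1 ≤ Real.exp 1 := Real.one_le_exp zero_le_one
  have hT : existenceTime (k + 1) A κ ω ≤ κ ^ (k * ν + 1) /
      (2 * k * Real.exp 1 * box (k + 1) ν A κ ^ k * 12 ^ (k * ν + 1) * waveSize ω) := by
    refine (min_le_right _ _).trans (le_of_eq ?_)
    rw [Nat.add_sub_cancel]
    push_cast
    rw [add_sub_cancel_right]
  refine (mul_le_mul_of_nonneg_left hT (by positivity)).trans ?_
  have heq : 2 * waveSize ω * box (k + 1) ν A κ ^ k * (κ ^ (k * ν + 1) /
      (2 * k * Real.exp 1 * box (k + 1) ν A κ ^ k * 12 ^ (k * ν + 1) * waveSize ω))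
      = κ ^ (k * ν + 1) / (k * Real.exp 1 * 12 ^ (k * ν + 1)) := by
    field_simp
  rw [heq]
  have h1 : κ ^ (k * ν + 1) ≤ κ := by
    simpa using pow_le_pow_of_le_one hκ.le hκ1 (Nat.le_add_left 1 (k * ν))
  have h2 : (12 : ℝ) ≤ 12 ^ (k * ν + 1) := by
    simpa using pow_le_pow_right₀ (by norm_num : (1 : ℝ) ≤ 12) (Nat.le_add_left 1 (k * ν))
  have h3 : 1 * 1 * 12 ≤ (k : ℝ) * Real.exp 1 * 12 ^ (k * ν + 1) := by gcongr
  rw [one_mul, one_mul] at h3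
  gcongr

/-- The decay rate `κ` splits as `3κ/5 + 2κ/5`: the first part is the initial weight, the second is
spent on summation. At `x = 2κ/5` each dimension costs `(2 + x)/x = 5/κ + 1 ≤ 6/κ`, which is the
base in `□`. -/
theorem summable_norm_mul_exp {p : ℕ} {A κ : ℝ} (hA : 0 < A) (hκ : 0 < κ) (hκ1 : κ ≤ 1)
    {c : (Fin ν → ℤ) → ℂ}
    (hc : ∀ n, ‖c n‖ ≤ A ^ (1 / ((p : ℝ) - 1)) * Real.exp (-κ * latticeSize n)) :
    (Summable fun n => ‖c n‖ * Real.exp (3 * κ / 5 * latticeSize n)) ∧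
      ∑' n, ‖c n‖ * Real.exp (3 * κ / 5 * latticeSize n) ≤ box p ν A κ / 2 := by
  have hx : 0 < 2 * κ / 5 := by positivity
  have hle : ∀ s : Finset (Fin ν → ℤ), ∑ n ∈ s, ‖c n‖ * Real.exp (3 * κ / 5 * latticeSize n)
      ≤ box p ν A κ / 2 := by
    intro s
    have h1 : (2 + 2 * κ / 5) / (2 * κ / 5) ≤ 6 * κ⁻¹ := by
      rw [div_le_iff₀ hx]
      field_simp
      linarith
    calc ∑ n ∈ s, ‖c n‖ * Real.exp (3 * κ / 5 * latticeSize n)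
        ≤ ∑ n ∈ s, A ^ (1 / ((p : ℝ) - 1)) * Real.exp (-(2 * κ / 5) * latticeSize n) := by
          refine Finset.sum_le_sum fun n _ => ?_
          refine (mul_le_mul_of_nonneg_right (hc n) (Real.exp_pos _).le).trans (le_of_eq ?_)
          rw [mul_assoc, ← Real.exp_add]
          ring_nf
      _ = A ^ (1 / ((p : ℝ) - 1)) * ∑ n ∈ s, Real.exp (-(2 * κ / 5) * latticeSize n) :=
          (Finset.mul_sum _ _ _).symm
      _ ≤ A ^ (1 / ((p : ℝ) - 1)) * (6 * κ⁻¹) ^ ν := by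
          gcongr
          exact (sum_exp_neg_mul_latticeSize_le hx s).trans (by gcongr)
      _ = box p ν A κ / 2 := by unfold box; ring
  have hnn : ∀ n, 0 ≤ ‖c n‖ * Real.exp (3 * κ / 5 * latticeSize n) := fun n => by positivity
  exact ⟨summable_of_sum_le hnn hle, Real.tsum_le_of_sum_le hnn hle⟩

end Constants

end GKdV

/-! ### Assembly of the theorem -/

theorem theorem1 (p ν : ℕ) (hp : 2 ≤ p) (hν : 1 ≤ ν)
    (ω : Fin ν → ℝ) (hω : GKdV.RationallyIndependent ω)
    (A κ : ℝ) (hA : 0 < A) (hκ : 0 < κ) (hκ1 : κ ≤ 1)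
    (c : (Fin ν → ℤ) → ℂ)
    (hc : ∀ n, ‖c n‖ ≤ A ^ (1 / ((p : ℝ) - 1)) * Real.exp (-κ * GKdV.latticeSize n))
    (u₀ : ℝ → ℂ) (hu₀ : GKdV.HasFourierExpansion ω c u₀) :
    0 < GKdV.existenceTime p A κ ω ∧
    ∃ (u : ℝ → ℝ → ℂ) (cd : ℝ → (Fin ν → ℤ) → ℂ),
      (∀ t ∈ Set.Ico 0 (GKdV.existenceTime p A κ ω), GKdV.HasFourierExpansion ω (cd t) (u t)) ∧
      GKdV.IsClassicalSolution p (GKdV.existenceTime p A κ ω) u ∧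
      (∀ x : ℝ, u 0 x = u₀ x) ∧
      (∀ t ∈ Set.Ico 0 (GKdV.existenceTime p A κ ω), ∀ n : Fin ν → ℤ,
        ‖cd t n‖ ≤ GKdV.box p ν A κ * Real.exp (-(κ / 2) * GKdV.latticeSize n)) := by
  have hW := GKdV.waveSize_pos hν hω
  have hT := GKdV.existenceTime_pos hp hA hκ hW
  refine ⟨hT, ?_⟩
  obtain ⟨k, rfl⟩ : ∃ k, p = k + 1 := ⟨p - 1, by omega⟩
  have hk : 1 ≤ k := by omega
  have hR := GKdV.box_pos (k + 1) ν hA hκ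
  have hbT := GKdV.mul_existenceTime_le hk hA hκ hκ1 hW
  obtain ⟨hcs, hcR⟩ := GKdV.summable_norm_mul_exp hA hκ hκ1 hc
  set T := GKdV.existenceTime (k + 1) A κ ω
  set R := GKdV.box (k + 1) ν A κ
  -- The speed of shrinking is the smallest that the contraction permits.
  have hb : 0 < 2 * GKdV.waveSize ω * R ^ k := by positivity
  obtain ⟨f, g, hf, hpow, hfg⟩ := GKdV.exists_mild_solution ω hb hT.le k
    (hbT.trans (by linarith)) hR.le le_rfl hcs hcR
  set b := 2 * GKdV.waveSize ω * R ^ k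
  set α : ℝ → ℝ := fun t => 3 * κ / 5 - b * GKdV.clamp T t with hα
  have hαc : Continuous α := by
    have := GKdV.continuous_clamp T
    fun_prop
  have hr : 0 < κ / 2 := by positivity
  -- The margin `3κ/5 - κ/2 = κ/10` exceeds the loss `b T ≤ κ/12`.
  have hαr : ∀ t, κ / 2 ≤ α t := fun t => by
    have := mul_le_mul_of_nonneg_left (GKdV.clamp_le hT.le t) hb.le
    simp only [hα]
    linarith
  have hexp : ∀ (h : lp (fun _ : Fin ν → ℤ => BoundedContinuousFunction ℝ ℂ) 1) t,
      GKdV.HasFourierExpansion ω (GKdV.unweight α h t) (GKdV.fourierSum ω α h 0 t) := fun h t x => by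
    simpa using GKdV.hasSum_fourierSum ω hr hαr h 0 t x
  have hduh := fun n t ht => GKdV.unweight_eq_duhamel ω k ht (hfg n t ht)
  refine ⟨GKdV.fourierSum ω α f 0, GKdV.unweight α f, fun t _ => hexp f t,
    GKdV.isClassicalSolution_fourierSum ω hαc hr hαr k
      (fun t x => (hexp g t x).unique (hpow t x _ (hexp f t x))) hduh, fun x => ?_, fun t _ n => ?_⟩
  · refine (hexp f 0 x).unique ?_
    have h0 : GKdV.unweight α f 0 = c := funext fun n => by
      simpa using hduh n 0 ⟨le_rfl, hT.le⟩
    rw [h0]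
    exact hu₀ x
  · refine (GKdV.norm_unweight_le (hαr t) f n).trans ?_
    gcongr
    exact (lp.norm_apply_le_norm (by simp) f n).trans hf
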